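/- **Theorem 1.1.** There exist numerical constants $\alpha, C, c, K > 0$ such that the following holds for all integers $1 \le m < n$. Let $A$ be an $m\times n$ random matrix whose entries are iid Gaussian variables with mean $0$ and variance $1/m$, and put $\lambda = 1/\sqrt{\log(n/m)+1}$. Then there is an event of probability at least $1 - C e^{-cm}$ on which, simultaneously for all $x\in\mathbb{R}^n$ with $\|x\|_0 \le \alpha m/(\log(n/m)+1)$, all $f\in\mathbb{R}^m$ with $\|f\|_0\le \alpha m$, all $\epsilon\ge 0$ and all $w\in\mathbb{R}^m$ with $\|w\|_2\le\epsilon$, the following is true with $y = Ax+f+w$: the convex program $$\min_{\tilde x\in\mathbb{R}^n,\ \tilde f\in\mathbb{R}^m}\ \|\tilde x\|_1+\lambda\|\tilde f\|_1\quad\text{such that}\quad \|(A\tilde x+\tilde f)-y\|_2\le\epsilon$$ has a solution, and every solution $(\hat x,\hat f)$ satisfies $$\|\hat x-x\|_2+\|\hat f-f\|_2\le K\epsilon .$$ Here $\|v\|_0$ denotes the number of nonzero coordinates of $v$, and $\|v\|_1$, $\|v\|_2$ its $\ell_1$ and Euclidean norms. -/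

import Mathlib

open MeasureTheory ProbabilityTheory

/-- `‖v‖₀`: the number of nonzero coordinates of `v`. -/
noncomputable def l0norm {k : ℕ} (v : EuclideanSpace ℝ (Fin k)) : ℕ :=
  (Finset.univ.filter (fun i => v i ≠ 0)).card

/-- `‖v‖₁`: the sum of the absolute values of the coordinates of `v`. -/
noncomputable def l1norm {k : ℕ} (v : EuclideanSpace ℝ (Fin k)) : ℝ :=
  ∑ i, |v i|

/-- The product `A x` as a vector of Euclidean space. -/
def applyMat {m n : ℕ} (A : Matrix (Fin m) (Fin n) ℝ) (x : EuclideanSpace ℝ (Fin n)) :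
    EuclideanSpace ℝ (Fin m) :=
  WithLp.toLp 2 (A.mulVec x.ofLp)

/-- `A` is a random `m × n` matrix, on the probability space `(Ω, P)`, whose entries are
independent Gaussian variables with mean `0` and variance `1 / m`. -/
structure IsGaussianSensingMatrix {Ω : Type*} [MeasurableSpace Ω] (P : Measure Ω) {m n : ℕ}
    (A : Ω → Matrix (Fin m) (Fin n) ℝ) : Prop where
  law : ∀ i j, HasLaw (fun ω => A ω i j) (gaussianReal 0 (1 / (m : NNReal))) P
  indep : iIndepFun (fun (p : Fin m × Fin n) ω => A ω p.1 p.2) P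

/-- The weight `λ(n, m) = 1 / √(log (n / m) + 1)`. -/
noncomputable def lam (n m : ℕ) : ℝ :=
  1 / Real.sqrt (Real.log ((n : ℝ) / (m : ℝ)) + 1)

/-- The pairs `(x̃, f̃)` satisfying the constraint `‖(A x̃ + f̃) - y‖₂ ≤ ε`. -/
def feasibleSet {m n : ℕ} (A : Matrix (Fin m) (Fin n) ℝ) (y : EuclideanSpace ℝ (Fin m)) (ε : ℝ) :
    Set (EuclideanSpace ℝ (Fin n) × EuclideanSpace ℝ (Fin m)) :=
  {p | ‖(applyMat A p.1 + p.2) - y‖ ≤ ε}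

/-- `(xhat, fhat)` solves: minimize `‖x̃‖₁ + lm * ‖f̃‖₁` subject to `‖(A x̃ + f̃) - y‖₂ ≤ ε`. -/
def IsSolution {m n : ℕ} (A : Matrix (Fin m) (Fin n) ℝ) (y : EuclideanSpace ℝ (Fin m))
    (ε lm : ℝ) (xhat : EuclideanSpace ℝ (Fin n)) (fhat : EuclideanSpace ℝ (Fin m)) : Prop :=
  (xhat, fhat) ∈ feasibleSet A y ε ∧
    IsMinOn (fun p : EuclideanSpace ℝ (Fin n) × EuclideanSpace ℝ (Fin m) =>
      l1norm p.1 + lm * l1norm p.2) (feasibleSet A y ε) (xhat, fhat)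

/-! Put `h = xhat - x`, `g = fhat - f`, `L = log (n / m) + 1`. Minimality and sparsity bound `l1norm
h` and `l1norm g` by `q √κ (‖h‖ + ‖g‖)` and `q √κ' (‖h‖ + ‖g‖)`, with `κ ~ m / L`, `κ' ~ m` and `q`
small; the weight `1 / √L` balances the two blocks. Feasibility gives `‖A h + g‖ ≤ 2 ε`, so it
suffices that `(h, g) ↦ A h + g` is bounded below on this cone (`norm_applyMat_add_ge`). Expanding
the square, this needs `⟨A h, g⟩` small (`ChevetBound`) and `‖A h‖` nearly at least `‖h‖ / 2`
(`norm_applyMat_ge`).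

Both follow from union bounds in which integer points play the role of nets. A vector bounded in
`ℓ₁` and `ℓ₂`, suitably scaled, is an integer vector plus a remainder with entries in `[-1, 1]`;
linear functionals of the remainder are dominated by their values at sign vectors of small support
(`exists_int_sum_mul_le`). A generating function counts the integer points (`card_intBall_le`), and
the entropy `κ log (n / κ)` is a small multiple of `m` thanks to the factor `1 / L` in `κ`
(`entropy_le`). -/

/-! ### Rounding to integer points -/

/-- Rounding of a real number to an integer, towards zero. -/
noncomputable def truncInt (a : ℝ) : ℤ := if 0 ≤ a then ⌊a⌋ else ⌈a⌉

theorem abs_truncInt_le (a : ℝ) : |(truncInt a : ℝ)| ≤ |a| := by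
  unfold truncInt
  split_ifs with h
  · have := Int.floor_le a
    have h0 : (0 : ℝ) ≤ (⌊a⌋ : ℝ) := by exact_mod_cast Int.floor_nonneg.2 h
    rwa [abs_of_nonneg h0, abs_of_nonneg h]
  · push Not at h
    have := Int.le_ceil a
    have h0 : ((⌈a⌉ : ℤ) : ℝ) ≤ 0 := by exact_mod_cast Int.ceil_le.2 (by simpa using h.le)
    rw [abs_of_nonpos h0, abs_of_neg h]
    linarith

theorem abs_sub_truncInt_le_one (a : ℝ) : |a - truncInt a| ≤ 1 := by
  unfold truncInt
  split_ifs with h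
  · have := Int.floor_le a
    have := Int.lt_floor_add_one a
    rw [abs_le]; constructor <;> linarith
  · have := Int.le_ceil a
    have := Int.ceil_lt_add_one a
    rw [abs_le]; constructor <;> linarith

theorem abs_sub_truncInt_le (a : ℝ) : |a - truncInt a| ≤ |a| := by
  unfold truncInt
  split_ifs with h
  · have := Int.floor_le a
    have h0 : (0 : ℝ) ≤ (⌊a⌋ : ℝ) := by exact_mod_cast Int.floor_nonneg.2 h
    rw [abs_of_nonneg h, abs_le]; constructor <;> linarith
  · push Not at h
    have := Int.le_ceil a
    have h0 : ((⌈a⌉ : ℤ) : ℝ) ≤ 0 := by exact_mod_cast Int.ceil_le.2 (by simpa using h.le)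
    rw [abs_of_neg h, abs_le]; constructor <;> linarith

/-- A finite family of reals has a subset of `k` largest elements. -/
theorem exists_finset_largest {ι : Type*} [Fintype ι] [DecidableEq ι] (w : ι → ℝ) (k : ℕ) :
    ∃ S : Finset ι, S.card ≤ k ∧ (S.card = k ∨ S = Finset.univ) ∧
      ∀ i ∈ S, ∀ j, j ∉ S → w j ≤ w i := by
  induction k with
  | zero => exact ⟨∅, by simp⟩
  | succ k ih =>
    obtain ⟨S, hk, hS, htop⟩ := ih
    rcases hS with hS | hS
    · by_cases hne : (Sᶜ).Nonempty
      · obtain ⟨j, hj, hmax⟩ := Finset.exists_max_image Sᶜ w hne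
        have hj' : j ∉ S := by simpa using hj
        refine ⟨insert j S, ?_, Or.inl ?_, ?_⟩
        · rw [Finset.card_insert_of_notMem hj']; omega
        · rw [Finset.card_insert_of_notMem hj']; omega
        · intro i hi l hl
          have hl' : l ∉ S := fun h => hl (Finset.mem_insert_of_mem h)
          rcases Finset.mem_insert.1 hi with rfl | hi
          · exact hmax l (by simpa using hl')
          · exact htop i hi l hl'
      · have : S = Finset.univ := by
          rw [Finset.not_nonempty_iff_eq_empty] at hne
          simpa using hne
        exact ⟨S, by omega, Or.inr this, htop⟩
    · exact ⟨S, by omega, Or.inr hS, htop⟩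

/-- A linear functional on the polytope `‖r‖_∞ ≤ 1`, `‖r‖₁ ≤ k` is at most the sum of the absolute
values of some `k` of its coefficients. -/
theorem exists_finset_sum_mul_le {ι : Type*} [Fintype ι] (v r : ι → ℝ) (k : ℕ)
    (h1 : ∀ i, |r i| ≤ 1) (hk : ∑ i, |r i| ≤ k) :
    ∃ S : Finset ι, S.card ≤ k ∧ ∑ i, v i * r i ≤ ∑ i ∈ S, |v i| := by
  classical
  obtain ⟨S, hSk, hS, htop⟩ := exists_finset_largest (fun i => |v i|) k
  refine ⟨S, hSk, ?_⟩
  have habs : ∑ i, v i * r i ≤ ∑ i, |v i| * |r i| :=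
    Finset.sum_le_sum fun i _ => (le_abs_self _).trans (abs_mul _ _).le
  refine habs.trans ?_
  rcases hS with hS | rfl
  · rcases S.eq_empty_or_nonempty with rfl | hne
    · have hk0 : (k : ℝ) = 0 := by simp [← hS]
      have hz : ∀ i, |r i| = 0 := by
        have := (Finset.sum_eq_zero_iff_of_nonneg (fun i (_ : i ∈ Finset.univ) =>
          abs_nonneg (r i))).1 (le_antisymm (hk.trans hk0.le)
            (Finset.sum_nonneg fun i _ => abs_nonneg _))
        exact fun i => this i (Finset.mem_univ i)
      simp [hz]
    · obtain ⟨i0, hi0, hmin⟩ := Finset.exists_min_image S (fun i => |v i|) hne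
      have hsplit := Finset.sum_add_sum_compl S (fun i => |r i|)
      -- Mass of `|r|` outside `S` fits into the slack `1 - |r i|` on `S`. Moving it there does not
      -- decrease the sum, with `|v i0|`, the least value on `S`, as the threshold.
      have hc : ∑ i ∈ Sᶜ, |v i| * |r i| ≤ |v i0| * ∑ i ∈ Sᶜ, |r i| := by
        rw [Finset.mul_sum]
        refine Finset.sum_le_sum fun i hi => ?_
        exact mul_le_mul_of_nonneg_right (htop i0 hi0 i (by simpa using hi)) (abs_nonneg _)
      have hd : |v i0| * ∑ i ∈ S, (1 - |r i|) ≤ ∑ i ∈ S, |v i| * (1 - |r i|) := by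
        rw [Finset.mul_sum]
        refine Finset.sum_le_sum fun i hi => ?_
        exact mul_le_mul_of_nonneg_right (hmin i hi) (by linarith [h1 i])
      have he : ∑ i ∈ S, (1 - |r i|) = k - ∑ i ∈ S, |r i| := by simp [← hS]
      have hf : |v i0| * ∑ i ∈ Sᶜ, |r i| ≤ |v i0| * ∑ i ∈ S, (1 - |r i|) :=
        mul_le_mul_of_nonneg_left (by linarith) (abs_nonneg _)
      have hg : ∑ i ∈ S, |v i| * (1 - |r i|) = ∑ i ∈ S, |v i| - ∑ i ∈ S, |v i| * |r i| := by
        rw [← Finset.sum_sub_distrib]; exact Finset.sum_congr rfl fun i _ => by ring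
      rw [← Finset.sum_add_sum_compl S]
      linarith
  · exact Finset.sum_le_sum fun i _ => mul_le_of_le_one_right (abs_nonneg _) (h1 i)

/-- Linear functionals on `{‖u‖₁ ≤ k, ‖u‖₂² ≤ R}` are controlled by their values at
integer points. -/
theorem exists_int_sum_mul_le {ι : Type*} [Fintype ι] (v u : ι → ℝ) (k : ℕ) (R : ℝ)
    (h1 : ∑ i, |u i| ≤ k) (h2 : ∑ i, u i ^ 2 ≤ R) :
    ∃ z z' : ι → ℤ, ∑ i, (z i : ℝ) ^ 2 ≤ R ∧ ∑ i, (z' i : ℝ) ^ 2 ≤ k ∧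
      ∑ i, v i * u i ≤ ∑ i, v i * z i + ∑ i, v i * z' i := by
  classical
  obtain ⟨S, hS, hle⟩ := exists_finset_sum_mul_le v (fun i => u i - truncInt (u i)) k
    (fun i => abs_sub_truncInt_le_one _)
    ((Finset.sum_le_sum fun i _ => abs_sub_truncInt_le _).trans h1)
  refine ⟨fun i => truncInt (u i), fun i => if i ∈ S then (if 0 ≤ v i then 1 else -1) else 0,
    ?_, ?_, ?_⟩
  · exact (Finset.sum_le_sum fun i _ => sq_le_sq.2 (abs_truncInt_le _)).trans h2
  · have : ∀ i, (((if i ∈ S then (if 0 ≤ v i then 1 else -1) else 0 : ℤ)) : ℝ) ^ 2 =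
        if i ∈ S then 1 else 0 := by
      intro i; split_ifs <;> simp
    simp_rw [this]
    simpa using hS
  · have h3 : ∑ i, v i * (((if i ∈ S then (if 0 ≤ v i then 1 else -1) else 0 : ℤ)) : ℝ) =
        ∑ i ∈ S, |v i| := by
      rw [← Finset.sum_filter_add_sum_filter_not Finset.univ (· ∈ S)]
      simp only [Finset.filter_univ_mem]
      rw [Finset.sum_eq_zero (s := Finset.univ.filter (· ∉ S)), add_zero]
      · refine Finset.sum_congr rfl fun i hi => ?_
        rw [if_pos hi]
        split_ifs with h
        · simp [abs_of_nonneg h]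
        · simp [abs_of_neg (not_le.1 h)]
      · intro i hi
        simp [(Finset.mem_filter.1 hi).2]
    rw [h3]
    have h4 : ∑ i, v i * (u i - truncInt (u i)) =
        ∑ i, v i * u i - ∑ i, v i * truncInt (u i) := by
      rw [← Finset.sum_sub_distrib]; exact Finset.sum_congr rfl fun i _ => by ring
    linarith

/-! ### Counting integer points in a ball -/

/-- The integer points of squared length at most `R`. -/
noncomputable def intBall (ι : Type*) [Fintype ι] [DecidableEq ι] (R : ℝ) : Finset (ι → ℤ) :=
  (Fintype.piFinset fun _ => Finset.Icc (-⌈R⌉) ⌈R⌉).filter fun z => ∑ i, (z i : ℝ) ^ 2 ≤ R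

theorem mem_intBall {ι : Type*} [Fintype ι] [DecidableEq ι] {R : ℝ} {z : ι → ℤ} :
    z ∈ intBall ι R ↔ ∑ i, (z i : ℝ) ^ 2 ≤ R := by
  simp only [intBall, Finset.mem_filter, Fintype.mem_piFinset, Finset.mem_Icc, and_iff_right_iff_imp]
  intro h i
  have h1 : (z i : ℝ) ^ 2 ≤ R :=
    (Finset.single_le_sum (f := fun i => (z i : ℝ) ^ 2) (fun i _ => sq_nonneg _)
      (Finset.mem_univ i)).trans h
  have h2 : ((z i ^ 2 : ℤ) : ℝ) ≤ ((⌈R⌉ : ℤ) : ℝ) := by push_cast; exact h1.trans (Int.le_ceil R)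
  have h3 : z i ^ 2 ≤ ⌈R⌉ := by exact_mod_cast h2
  -- For integers `|z i| ≤ z i ^ 2`, so the box of half-side `⌈R⌉` loses no point.
  constructor <;> nlinarith [sq_nonneg (z i - 1), sq_nonneg (z i + 1), sq_nonneg (z i)]

theorem intBall_mono {ι : Type*} [Fintype ι] [DecidableEq ι] {R R' : ℝ} (h : R ≤ R') :
    intBall ι R ⊆ intBall ι R' := fun _ hz => mem_intBall.2 ((mem_intBall.1 hz).trans h)

/-- Since `j ^ 2 ≥ |j|`, a two-sided geometric series dominates the sum. The induction carries the
extra term `-4 * x ^ (N + 1)`, which pays for the two new endpoints because `x ≤ 1 / 2`. -/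
theorem sum_exp_neg_sq_Icc_le {x : ℝ} (hx0 : 0 < x) (hx : x ≤ 1 / 2) (N : ℤ) :
    ∑ j ∈ Finset.Icc (-N) N, x ^ (j ^ 2).toNat ≤ 1 + 4 * x := by
  have key : ∀ N : ℕ, ∑ j ∈ Finset.Icc (-(N : ℤ)) N, x ^ (j ^ 2).toNat ≤
      1 + 4 * x - 4 * x ^ (N + 1) := by
    intro N
    induction N with
    | zero => simp
    | succ N ih =>
      have hset : Finset.Icc (-((N + 1 : ℕ) : ℤ)) ((N + 1 : ℕ) : ℤ) =
          insert (-((N + 1 : ℕ) : ℤ)) (insert ((N + 1 : ℕ) : ℤ) (Finset.Icc (-(N : ℤ)) N)) := by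
        ext j
        simp only [Finset.mem_Icc, Finset.mem_insert]
        omega
      have hp : x ^ ((((N + 1 : ℕ) : ℤ) ^ 2).toNat) ≤ x ^ (N + 1) := by
        refine pow_le_pow_of_le_one hx0.le (by linarith) ?_
        have : (((N + 1 : ℕ) : ℤ) ^ 2).toNat = (N + 1) ^ 2 := by
          rw [← Nat.cast_pow]; exact Int.toNat_natCast _
        rw [this]
        nlinarith
      rw [hset, Finset.sum_insert, Finset.sum_insert, neg_sq]
      · have h3 : x ^ (N + 1 + 1) ≤ x ^ (N + 1) * (1 / 2) := by
          rw [pow_succ]; gcongr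
        linarith
      · simp
      · simp only [Finset.mem_insert, Finset.mem_Icc]; omega
  rcases le_or_gt 0 N with hN | hN
  · lift N to ℕ using hN
    have := key N
    have : 0 < x ^ (N + 1) := by positivity
    linarith
  · rw [Finset.Icc_eq_empty (by omega)]
    simp; positivity

/-- The number of integer points in a ball, in terms of a free parameter `x`. -/
theorem card_intBall_le_exp {ι : Type*} [Fintype ι] [DecidableEq ι] (R : ℝ) {x : ℝ} (hx0 : 0 < x)
    (hx : x ≤ 1 / 2) :
    ((intBall ι R).card : ℝ) ≤ Real.exp (R * Real.log x⁻¹ + 4 * x * Fintype.card ι) := by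
  -- Chernoff's device for counting: weight `z` by `x` to the power `|z|² - R`, which is at least
  -- `1` on the ball and factors over coordinates.
  have h1 : ∀ z ∈ intBall ι R,
      1 ≤ Real.exp (R * Real.log x⁻¹) * ∏ i, x ^ ((z i) ^ 2).toNat := by
    intro z hz
    have hz := mem_intBall.1 hz
    have hlog : 0 ≤ Real.log x⁻¹ :=
      Real.log_nonneg ((one_le_inv₀ hx0).2 (by linarith))
    have h2 : ∏ i, x ^ ((z i) ^ 2).toNat = Real.exp (-(∑ i, (z i : ℝ) ^ 2) * Real.log x⁻¹) := by
      rw [neg_mul, Finset.sum_mul, ← Finset.sum_neg_distrib, Real.exp_sum]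
      refine Finset.prod_congr rfl fun i _ => ?_
      have h3 : ((z i : ℝ)) ^ 2 = (((z i) ^ 2).toNat : ℝ) := by
        have : (((z i ^ 2).toNat : ℤ)) = z i ^ 2 := Int.toNat_of_nonneg (sq_nonneg _)
        have h4 : ((((z i ^ 2).toNat : ℤ)) : ℝ) = ((z i ^ 2 : ℤ) : ℝ) := by rw [this]
        push_cast at h4
        exact h4.symm
      rw [h3, Real.log_inv, mul_neg, neg_neg, ← Real.log_pow, Real.exp_log (by positivity)]
    rw [h2, ← Real.exp_add]
    apply Real.one_le_exp
    nlinarith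
  calc ((intBall ι R).card : ℝ) = ∑ z ∈ intBall ι R, 1 := by simp
    _ ≤ ∑ z ∈ intBall ι R, Real.exp (R * Real.log x⁻¹) * ∏ i, x ^ ((z i) ^ 2).toNat :=
        Finset.sum_le_sum h1
    _ ≤ ∑ z ∈ Fintype.piFinset fun _ : ι => Finset.Icc (-⌈R⌉) ⌈R⌉,
          Real.exp (R * Real.log x⁻¹) * ∏ i, x ^ ((z i) ^ 2).toNat :=
        Finset.sum_le_sum_of_subset_of_nonneg (Finset.filter_subset _ _)
          fun _ _ _ => by positivity
    _ = Real.exp (R * Real.log x⁻¹) *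
          ∏ _i : ι, ∑ j ∈ Finset.Icc (-⌈R⌉) ⌈R⌉, x ^ (j ^ 2).toNat := by
        rw [← Finset.mul_sum, Finset.prod_univ_sum]
    _ ≤ Real.exp (R * Real.log x⁻¹) * ∏ _i : ι, Real.exp (4 * x) := by
        gcongr with i _
        exact (sum_exp_neg_sq_Icc_le hx0 hx _).trans (by linarith [Real.add_one_le_exp (4 * x)])
    _ = _ := by
        rw [Finset.prod_const, ← Real.exp_nat_mul, ← Real.exp_add, Finset.card_univ]
        ring_nf

/-- The number of integer points of squared length at most `R`, if `κ ≤ min n (R / 2)`. -/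
theorem card_intBall_le {n : ℕ} {κ R : ℝ} (hκ : 0 < κ) (hκn : κ ≤ n) (hR : 2 * κ ≤ R) :
    ((intBall (Fin n) R).card : ℝ) ≤ Real.exp (R * (Real.log (2 * n / κ) + 1)) := by
  have hn : (0 : ℝ) < n := hκ.trans_le hκn
  refine (card_intBall_le_exp R (x := κ / (2 * n)) (by positivity) ?_).trans ?_
  · rw [div_le_iff₀ (by positivity)]; linarith
  · rw [Real.exp_le_exp, inv_div, mul_add, Fintype.card_fin]
    have : 4 * (κ / (2 * n)) * n = 2 * κ := by field_simp; norm_num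
    linarith

/-! ### Gaussian tail estimates -/

theorem hasSubgaussianMGF_of_le {Ω : Type*} {mΩ : MeasurableSpace Ω} {P : Measure Ω} {X : Ω → ℝ}
    {c d : NNReal} (h : HasSubgaussianMGF X c P) (hcd : c ≤ d) : HasSubgaussianMGF X d P where
  integrable_exp_mul := h.integrable_exp_mul
  mgf_le t := (h.mgf_le t).trans (by gcongr)

theorem hasSubgaussianMGF_of_hasLaw {Ω : Type*} {mΩ : MeasurableSpace Ω} {P : Measure Ω}
    {X : Ω → ℝ} {v : NNReal} (h : HasLaw X (gaussianReal 0 v) P) : HasSubgaussianMGF X v P := by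
  have hid : HasSubgaussianMGF id v (gaussianReal 0 v) :=
    ⟨fun t => integrable_exp_mul_gaussianReal t, fun t => by simp [mgf_id_gaussianReal]⟩
  rw [← h.map_eq] at hid
  exact HasSubgaussianMGF.of_map (X := id) h.aemeasurable hid

section

variable {Ω : Type*} [MeasurableSpace Ω] {P : Measure Ω} {m n : ℕ}
  {A : Ω → Matrix (Fin m) (Fin n) ℝ}

/-- Gaussian tail of the bilinear form `⟨A h, g⟩`. -/
theorem IsGaussianSensingMatrix.measureReal_bilin_ge_le [IsProbabilityMeasure P]
    (hA : IsGaussianSensingMatrix P A) (h : Fin n → ℝ) (g : Fin m → ℝ) {a b T : ℝ}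
    (ha : ∑ j, h j ^ 2 ≤ a) (hb : ∑ i, g i ^ 2 ≤ b) (hT : 0 ≤ T) :
    P.real {ω | T ≤ ∑ i, g i * (A ω).mulVec h i} ≤ Real.exp (-(T ^ 2 * m / (2 * (a * b)))) := by
  have ha0 : 0 ≤ a := (Finset.sum_nonneg fun _ _ => sq_nonneg _).trans ha
  have hb0 : 0 ≤ b := (Finset.sum_nonneg fun _ _ => sq_nonneg _).trans hb
  have hX : ∀ p : Fin m × Fin n, HasSubgaussianMGF (fun ω => (g p.1 * h p.2) * A ω p.1 p.2)
      ((g p.1 * h p.2) ^ 2 / m).toNNReal P := fun p =>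
    hasSubgaussianMGF_of_le ((hasSubgaussianMGF_of_hasLaw (hA.law p.1 p.2)).const_mul _) <| by
      rw [← NNReal.coe_le_coe, Real.coe_toNNReal _ (by positivity)]
      exact (div_eq_mul_one_div ((g p.1 * h p.2) ^ 2) (m : ℝ)).ge
  have hind : iIndepFun (fun (p : Fin m × Fin n) ω => (g p.1 * h p.2) * A ω p.1 p.2) P :=
    hA.indep.comp (fun p x => (g p.1 * h p.2) * x) (fun p => by fun_prop)
  have hsum := HasSubgaussianMGF.sum_of_iIndepFun hind (s := Finset.univ) (fun p _ => hX p)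
  have hle : ∑ p : Fin m × Fin n, ((g p.1 * h p.2) ^ 2 / m).toNNReal ≤ (a * b / m).toNNReal := by
    rw [← Real.toNNReal_sum_of_nonneg fun _ _ => by positivity]
    refine Real.toNNReal_le_toNNReal ?_
    rw [← Finset.sum_div, Fintype.sum_prod_type]
    simp_rw [mul_pow, ← Finset.mul_sum, ← Finset.sum_mul]
    rw [mul_comm]
    gcongr
  have := (hasSubgaussianMGF_of_le hsum hle).measure_ge_le hT
  have hset : {ω | T ≤ ∑ i, g i * (A ω).mulVec h i} =
      {ω | T ≤ ∑ p : Fin m × Fin n, (g p.1 * h p.2) * A ω p.1 p.2} := by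
    ext ω
    simp only [Set.mem_ofPred_eq, Fintype.sum_prod_type, Matrix.mulVec, dotProduct, Finset.mul_sum]
    simp_rw [show ∀ i j, g i * (A ω i j * h j) = g i * h j * A ω i j from fun i j => by ring]
  rw [hset]
  refine this.trans (Real.exp_le_exp.2 (le_of_eq ?_))
  rw [Real.coe_toNNReal _ (by positivity), neg_div]
  congr 1
  rcases eq_or_ne (m : ℝ) 0 with hm | hm
  · simp [hm]
  rcases eq_or_ne (a * b) 0 with hab | hab
  · simp [hab]
  field_simp

theorem integral_exp_neg_sq_div_gaussianReal {v : NNReal} (hv : v ≠ 0) :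
    ∫ x, Real.exp (-(1 / (v : ℝ)) * x ^ 2) ∂(gaussianReal 0 v) = 1 / √3 := by
  have hv' : (0 : ℝ) < v := by positivity
  rw [integral_gaussianReal_eq_integral_smul hv]
  simp only [gaussianPDFReal, smul_eq_mul, mul_assoc, ← Real.exp_add]
  rw [integral_const_mul]
  have : ∀ x : ℝ, -(x - 0) ^ 2 / (2 * (v : ℝ)) + -(1 / (v : ℝ)) * x ^ 2 =
      -(3 / (2 * (v : ℝ))) * x ^ 2 := by
    intro x; field_simp; ring
  simp_rw [this]
  rw [integral_gaussian, ← Real.sqrt_inv, ← Real.sqrt_mul (by positivity), one_div, ← Real.sqrt_inv]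
  congr 1
  field_simp

/-- Covariances of the coordinates of `A h`. -/
theorem IsGaussianSensingMatrix.covariance_mulVec [IsProbabilityMeasure P]
    (hA : IsGaussianSensingMatrix P A) (h : Fin n → ℝ) (i k : Fin m) :
    cov[fun ω => (A ω).mulVec h i, fun ω => (A ω).mulVec h k; P] =
      if i = k then (∑ j, h j ^ 2) / m else 0 := by
  have hL2 : ∀ i j, MemLp (fun ω => A ω i j) 2 P := fun i j =>
    (hA.law i j).hasGaussianLaw.memLp_two
  have hcov : ∀ j l, cov[fun ω => A ω i j, fun ω => A ω k l; P] =
      if i = k ∧ j = l then 1 / (m : ℝ) else 0 := by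
    intro j l
    split_ifs with hc
    · obtain ⟨rfl, rfl⟩ := hc
      rw [covariance_self (hA.law i j).aemeasurable, (hA.law i j).variance_eq]
      simp
    · refine (hA.indep.indepFun (i := (i, j)) (j := (k, l)) ?_).covariance_eq_zero (hL2 i j)
        (hL2 k l)
      simpa [Prod.ext_iff] using hc
  simp only [Matrix.mulVec, dotProduct]
  rw [covariance_fun_sum_fun_sum]
  · simp_rw [covariance_mul_const_left, covariance_mul_const_right, hcov]
    split_ifs with hik
    · simp [hik, Finset.sum_div]
      exact Finset.sum_congr rfl fun j _ => by ring
    · simp [hik]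
  · intro j; simpa [mul_comm] using (hL2 i j).const_mul (h j)
  · intro j; simpa [mul_comm] using (hL2 k j).const_mul (h j)

theorem IsGaussianSensingMatrix.hasGaussianLaw_mulVec [IsProbabilityMeasure P]
    (hA : IsGaussianSensingMatrix P A) (h : Fin n → ℝ) :
    HasGaussianLaw (fun ω i => (A ω).mulVec h i) P := by
  have hG : HasGaussianLaw (fun ω => fun p : Fin m × Fin n => A ω p.1 p.2) P :=
    hA.indep.hasGaussianLaw fun p => (hA.law p.1 p.2).hasGaussianLaw
  have := hG.map_fun (ContinuousLinearMap.pi fun i : Fin m =>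
    ∑ j, h j • ContinuousLinearMap.proj (R := ℝ) (φ := fun _ : Fin m × Fin n => ℝ) (i, j))
  convert! this using 3 with ω i
  simp [Matrix.mulVec, dotProduct, mul_comm]

theorem IsGaussianSensingMatrix.map_mulVec_eq [IsProbabilityMeasure P]
    (hA : IsGaussianSensingMatrix P A) (h : Fin n → ℝ) (i : Fin m) :
    P.map (fun ω => (A ω).mulVec h i) =
      gaussianReal 0 (Real.toNNReal ((∑ j, h j ^ 2) / m)) := by
  have hG := (hA.hasGaussianLaw_mulVec h).eval i
  rw [hG.map_eq_gaussianReal, ← covariance_self hG.aemeasurable, hA.covariance_mulVec, if_pos rfl]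
  congr 1
  simp only [Matrix.mulVec, dotProduct]
  rw [integral_finsetSum]
  · refine Finset.sum_eq_zero fun j _ => ?_
    rw [integral_mul_const, (hA.law i j).integral_eq]
    simp
  · exact fun j _ => (hA.law i j).hasGaussianLaw.integrable.mul_const _

/-- Lower tail of `‖A h‖₂`. -/
theorem IsGaussianSensingMatrix.measureReal_sum_sq_lt_le [IsProbabilityMeasure P]
    (hA : IsGaussianSensingMatrix P A) (hm : 0 < m) (h : Fin n → ℝ) :
    P.real {ω | ∑ i, (A ω).mulVec h i ^ 2 < (∑ j, h j ^ 2) / 4} ≤ Real.exp (-(m / 4 : ℝ)) := by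
  have hm' : (0 : ℝ) < m := by exact_mod_cast hm
  rcases (Finset.sum_nonneg fun j (_ : j ∈ Finset.univ) => sq_nonneg (h j)).eq_or_lt with h0 | h0
  · have : {ω | ∑ i, (A ω).mulVec h i ^ 2 < (∑ j, h j ^ 2) / 4} = ∅ := by
      ext ω
      rw [← h0]
      simp only [zero_div, Set.mem_ofPred_eq, Set.mem_empty_iff_false, iff_false, not_lt]
      exact Finset.sum_nonneg fun _ _ => sq_nonneg _
    rw [this]
    simp only [measureReal_empty]
    positivity
  set s : ℝ := (∑ j, h j ^ 2) / m with hs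
  have hs0 : 0 < s := by positivity
  have hG := hA.hasGaussianLaw_mulVec h
  -- Jointly Gaussian and uncorrelated coordinates are independent.
  have hind : iIndepFun (fun i ω => (A ω).mulVec h i) P :=
    hG.iIndepFun_of_covariance_eq_zero fun i j hij => by
      rw [hA.covariance_mulVec, if_neg hij]
  have hind2 : iIndepFun (fun i ω => (A ω).mulVec h i ^ 2) P :=
    hind.comp (fun _ x => x ^ 2) (fun _ => by fun_prop)
  have hmeas : ∀ i, AEMeasurable (fun ω => (A ω).mulVec h i) P := fun i => (hG.eval i).aemeasurable
  have hmgf1 : ∀ i, mgf (fun ω => (A ω).mulVec h i ^ 2) P (-(1 / s)) = 1 / √3 := by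
    intro i
    have h2 := integral_exp_neg_sq_div_gaussianReal (v := s.toNNReal) (by simpa using hs0)
    rw [Real.coe_toNNReal _ hs0.le, ← hA.map_mulVec_eq h i, integral_map (hmeas i)] at h2
    · exact h2
    · exact (by fun_prop : Measurable fun x : ℝ => Real.exp (-(1 / s) * x ^ 2)).aestronglyMeasurable
  have hmgf : mgf (∑ i, fun ω => (A ω).mulVec h i ^ 2) P (-(1 / s)) = (1 / √3) ^ m := by
    rw [hind2.mgf_sum₀ (fun i => (hmeas i).pow_const 2)]
    simp_rw [hmgf1]
    simp
  have hint : Integrable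
      (fun ω => Real.exp (-(1 / s) * (∑ i, fun ω => (A ω).mulVec h i ^ 2) ω)) P := by
    refine Integrable.of_bound (C := 1) ?_ (Filter.Eventually.of_forall fun ω => ?_)
    · have : AEMeasurable (∑ i, fun ω => (A ω).mulVec h i ^ 2) P :=
        Finset.aemeasurable_sum _ fun i _ => (hmeas i).pow_const 2
      exact (this.const_mul _).exp.aestronglyMeasurable
    · rw [Real.norm_eq_abs, Real.abs_exp, Real.exp_le_one_iff, Finset.sum_apply]
      have : 0 ≤ ∑ i, (A ω).mulVec h i ^ 2 := Finset.sum_nonneg fun _ _ => sq_nonneg _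
      have : 0 ≤ 1 / s := by positivity
      nlinarith
  -- Chernoff at `t = -1 / s`, where each factor of the moment generating function is `1 / √3 ≤ exp
  -- (-1 / 2)`; this beats the prefactor `exp (m / 4)`.
  have hmk := measure_le_le_exp_mul_mgf (μ := P) ((∑ j, h j ^ 2) / 4)
    (t := -(1 / s)) (by simp [hs0.le]) hint
  refine (measureReal_mono ?_).trans (hmk.trans ?_)
  · intro ω hω
    simp only [Set.mem_ofPred_eq, Finset.sum_apply] at hω ⊢
    exact hω.le
  · rw [hmgf]
    have h5 : - -(1 / s) * ((∑ j, h j ^ 2) / 4) = m / 4 := by rw [hs]; field_simp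
    have h6 : (1 / √3) ≤ Real.exp (-(1 / 2)) := by
      rw [Real.exp_neg, one_div]
      gcongr
      rw [Real.le_sqrt (by positivity) (by norm_num), ← Real.exp_nat_mul]
      norm_num
      linarith [Real.exp_one_lt_d9]
    calc _ ≤ Real.exp (m / 4) * Real.exp (-(1 / 2)) ^ m := by rw [h5]; gcongr
      _ = Real.exp (-(m / 4 : ℝ)) := by
        rw [← Real.exp_nat_mul, ← Real.exp_add]; congr 1; ring

end

/-! ### Norms, and reduction of Chevet's bound to integer points -/

theorem norm_sq_eq_sum {k : ℕ} (v : EuclideanSpace ℝ (Fin k)) : ‖v‖ ^ 2 = ∑ i, v i ^ 2 := by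
  simp [EuclideanSpace.norm_sq_eq]

theorem l1norm_nonneg {k : ℕ} (v : EuclideanSpace ℝ (Fin k)) : 0 ≤ l1norm v :=
  Finset.sum_nonneg fun _ _ => abs_nonneg _

theorem l1norm_smul {k : ℕ} (a : ℝ) (v : EuclideanSpace ℝ (Fin k)) :
    l1norm (a • v) = |a| * l1norm v := by
  simp [l1norm, abs_mul, Finset.mul_sum]

theorem l1norm_le_sqrt_mul_norm {k : ℕ} (v : EuclideanSpace ℝ (Fin k)) :
    l1norm v ≤ ‖v‖ * √k := by
  refine le_of_sq_le_sq ?_ (by positivity)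
  rw [mul_pow, Real.sq_sqrt (by positivity), norm_sq_eq_sum]
  have := sq_sum_le_card_mul_sum_sq (s := Finset.univ) (f := fun i => |v i|)
  simp only [sq_abs, Finset.card_univ, Fintype.card_fin] at this
  rw [mul_comm]
  exact this

theorem applyMat_add {m n : ℕ} (A : Matrix (Fin m) (Fin n) ℝ) (x y : EuclideanSpace ℝ (Fin n)) :
    applyMat A (x + y) = applyMat A x + applyMat A y := by
  simp [applyMat, Matrix.mulVec_add]

theorem applyMat_smul {m n : ℕ} (A : Matrix (Fin m) (Fin n) ℝ) (a : ℝ)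
    (x : EuclideanSpace ℝ (Fin n)) : applyMat A (a • x) = a • applyMat A x := by
  simp [applyMat, Matrix.mulVec_smul]

theorem continuous_applyMat {m n : ℕ} (A : Matrix (Fin m) (Fin n) ℝ) :
    Continuous (applyMat A) := by
  unfold applyMat
  fun_prop

/-- `⟨A h, g⟩ ≤ D r s` whenever `h` and `g` lie in `r` and `s` times the sets of vectors of
Euclidean norm at most `1` and `ℓ₁`-norm at most `√κ` and `√κ'`. -/
def ChevetBound {m n : ℕ} (A : Matrix (Fin m) (Fin n) ℝ) (κ κ' D : ℝ) : Prop :=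
  ∀ (h : EuclideanSpace ℝ (Fin n)) (g : EuclideanSpace ℝ (Fin m)) (r s : ℝ),
    ‖h‖ ≤ r → l1norm h ≤ r * √κ → ‖g‖ ≤ s → l1norm g ≤ s * √κ' →
      ∑ i, g i * applyMat A h i ≤ D * r * s

/-- A linear functional on vectors of bounded `ℓ₁`- and Euclidean norm is controlled by its values
at integer points. -/
theorem sum_mul_le_of_intBall {n : ℕ} (v : Fin n → ℝ) (h : EuclideanSpace ℝ (Fin n)) {κ r M : ℝ}
    (hκ : 0 < κ) (hr : ‖h‖ ≤ r) (hr1 : l1norm h ≤ r * √κ)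
    (hM : ∀ z ∈ intBall (Fin n) (2 * ⌈κ⌉₊), ∑ i, v i * z i ≤ M) :
    ∑ i, v i * h i ≤ 2 * (√κ / ⌈κ⌉₊) * M * r := by
  have hM0 : 0 ≤ M := by
    have := hM 0 (mem_intBall.2 (by simp))
    simpa using this
  have hk : κ ≤ ⌈κ⌉₊ := Nat.le_ceil κ
  have hk1 : (1 : ℝ) ≤ ⌈κ⌉₊ := by exact_mod_cast Nat.one_le_ceil_iff.2 hκ
  set k := ⌈κ⌉₊
  have hsκ : 0 < √κ := Real.sqrt_pos.2 hκ
  have hsq : √κ ^ 2 = κ := Real.sq_sqrt hκ.le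
  rcases (norm_nonneg h |>.trans hr).eq_or_lt with rfl | hr0
  · have : h = 0 := norm_le_zero_iff.1 hr
    simp [this]
  -- This scaling turns the `ℓ₁` bound into the integer `k`.
  set c : ℝ := k / (r * √κ) with hc
  have hc0 : 0 < c := by positivity
  have hl1 : ∑ i, |c * h i| ≤ k := by
    simp_rw [abs_mul, abs_of_pos hc0, ← Finset.mul_sum]
    calc c * ∑ i, |h i| ≤ c * (r * √κ) := by gcongr; exact hr1
      _ = k := by rw [hc]; field_simp
  have hl2 : ∑ i, (c * h i) ^ 2 ≤ 2 * k := by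
    -- `κ` may be tiny. Then `k = 1` and the `ℓ₁` bound already controls the `ℓ₂` norm; otherwise `k
    -- ≤ 2 * κ`.
    rcases le_or_gt κ 1 with h1 | h1
    · have hk' : (k : ℝ) = 1 := by
        have : k ≤ 1 := Nat.ceil_le.2 (by simpa using h1)
        have : (k : ℝ) ≤ 1 := by exact_mod_cast this
        linarith
      calc ∑ i, (c * h i) ^ 2 = ∑ i, |c * h i| ^ 2 := by simp_rw [sq_abs]
        _ ≤ (∑ i, |c * h i|) ^ 2 := Finset.sum_sq_le_sq_sum_of_nonneg fun _ _ => abs_nonneg _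
        _ ≤ (k : ℝ) ^ 2 := by gcongr
        _ ≤ 2 * k := by rw [hk']; norm_num
    · have hk2 : (k : ℝ) ≤ 2 * κ := by linarith [Nat.ceil_lt_add_one hκ.le]
      calc ∑ i, (c * h i) ^ 2 = c ^ 2 * ‖h‖ ^ 2 := by
            rw [norm_sq_eq_sum, Finset.mul_sum]; simp_rw [mul_pow]
        _ ≤ c ^ 2 * r ^ 2 := by gcongr
        _ = k ^ 2 / κ := by rw [hc, div_pow, mul_pow, hsq]; field_simp
        _ ≤ 2 * k := by rw [div_le_iff₀ hκ]; nlinarith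
  obtain ⟨z, z', hz, hz', hle⟩ := exists_int_sum_mul_le v (fun i => c * h i) k (2 * k) hl1 hl2
  have h1 := hM z (mem_intBall.2 hz)
  have h2 := hM z' (mem_intBall.2 (hz'.trans (by linarith)))
  have h3 : ∑ i, v i * (c * h i) = c * ∑ i, v i * h i := by
    rw [Finset.mul_sum]; exact Finset.sum_congr rfl fun i _ => by ring
  rw [h3] at hle
  have h4 : ∑ i, v i * h i ≤ 2 * M / c := by
    rw [le_div_iff₀ hc0]; linarith
  refine h4.trans (le_of_eq ?_)
  rw [hc]; field_simp

/-- Discretize one variable at a time. Each use of `sum_mul_le_of_intBall` costs a factor `2`, and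
its ratio `√κ / ⌈κ⌉₊` cancels against the threshold. -/
theorem chevetBound_of_intBall {m n : ℕ} {A : Matrix (Fin m) (Fin n) ℝ} {κ κ' δ : ℝ}
    (hκ : 0 < κ) (hκ' : 0 < κ')
    (hA : ∀ z ∈ intBall (Fin n) (2 * ⌈κ⌉₊), ∀ w ∈ intBall (Fin m) (2 * ⌈κ'⌉₊),
      ∑ i, (w i : ℝ) * A.mulVec (fun j => (z j : ℝ)) i ≤ δ * (⌈κ⌉₊ / √κ) * (⌈κ'⌉₊ / √κ')) :
    ChevetBound A κ κ' (4 * δ) := by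
  intro h g r s hr hr1 hs hs1
  have hk1 : (1 : ℝ) ≤ ⌈κ⌉₊ := by exact_mod_cast Nat.one_le_ceil_iff.2 hκ
  have hl1 : (1 : ℝ) ≤ ⌈κ'⌉₊ := by exact_mod_cast Nat.one_le_ceil_iff.2 hκ'
  have hsκ : 0 < √κ := Real.sqrt_pos.2 hκ
  have hsκ' : 0 < √κ' := Real.sqrt_pos.2 hκ'
  have hswap : ∀ (w : Fin m → ℝ) (x : Fin n → ℝ),
      ∑ j, (∑ i, w i * A i j) * x j = ∑ i, w i * A.mulVec x i := by
    intro w x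
    simp only [Matrix.mulVec, dotProduct, Finset.mul_sum, Finset.sum_mul]
    rw [Finset.sum_comm]
    simp_rw [mul_assoc]
  have h1 : ∀ w ∈ intBall (Fin m) (2 * ⌈κ'⌉₊), ∑ i, applyMat A h i * (w i : ℝ) ≤
      2 * (√κ / ⌈κ⌉₊) * (δ * (⌈κ⌉₊ / √κ) * (⌈κ'⌉₊ / √κ')) * r := by
    intro w hw
    have := sum_mul_le_of_intBall (fun j => ∑ i, (w i : ℝ) * A i j) h hκ hr hr1
      (M := δ * (⌈κ⌉₊ / √κ) * (⌈κ'⌉₊ / √κ')) fun z hz => by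
        rw [hswap]; exact hA z hz w hw
    rw [hswap] at this
    exact (Finset.sum_congr rfl fun i _ => mul_comm _ _).trans_le this
  have h2 := sum_mul_le_of_intBall (fun i => applyMat A h i) g hκ' hs hs1 h1
  simp_rw [mul_comm (g _)]
  refine h2.trans (le_of_eq ?_)
  field_simp
  ring

/-! ### Union bounds over integer points -/

section

variable {Ω : Type*} [MeasurableSpace Ω] {P : Measure Ω} {m n : ℕ}
  {A : Ω → Matrix (Fin m) (Fin n) ℝ}

/-- A version of Chevet's inequality. -/
theorem IsGaussianSensingMatrix.measureReal_not_chevetBound_le [IsProbabilityMeasure P]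
    (hA : IsGaussianSensingMatrix P A) {κ κ' δ : ℝ} (hκ : 0 < κ) (hκn : κ ≤ n)
    (hκ' : 0 < κ') (hκm : κ' ≤ m) (hδ : 0 < δ)
    (hc : 2 * κ * (Real.log (2 * n / κ) + 1) ≤ δ ^ 2 * m / 32)
    (hc' : 2 * κ' * (Real.log (2 * m / κ') + 1) ≤ δ ^ 2 * m / 32) :
    P.real {ω | ¬ ChevetBound (A ω) κ κ' (4 * δ)} ≤ Real.exp (-(δ ^ 2 * m / 16)) := by
  have hk : κ ≤ ⌈κ⌉₊ := Nat.le_ceil κ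
  have hl : κ' ≤ ⌈κ'⌉₊ := Nat.le_ceil κ'
  have hk0 : (0 : ℝ) < ⌈κ⌉₊ := hκ.trans_le hk
  have hl0 : (0 : ℝ) < ⌈κ'⌉₊ := hκ'.trans_le hl
  have hsκ : 0 < √κ := Real.sqrt_pos.2 hκ
  have hsκ' : 0 < √κ' := Real.sqrt_pos.2 hκ'
  set T : ℝ := δ * (⌈κ⌉₊ / √κ) * (⌈κ'⌉₊ / √κ') with hT
  set a : ℝ := ⌈κ⌉₊ / κ with ha
  set b : ℝ := ⌈κ'⌉₊ / κ' with hb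
  have ha1 : 1 ≤ a := (one_le_div hκ).2 hk
  have hb1 : 1 ≤ b := (one_le_div hκ').2 hl
  have hsub : {ω | ¬ ChevetBound (A ω) κ κ' (4 * δ)} ⊆
      ⋃ p ∈ intBall (Fin n) (2 * ⌈κ⌉₊) ×ˢ intBall (Fin m) (2 * ⌈κ'⌉₊),
        {ω | T ≤ ∑ i, (p.2 i : ℝ) * (A ω).mulVec (fun j => (p.1 j : ℝ)) i} := by
    intro ω hω
    by_contra hcon
    refine hω (chevetBound_of_intBall hκ hκ' fun z hz w hw => ?_)
    simp only [Set.mem_iUnion, Set.mem_ofPred_eq, not_exists, not_le] at hcon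
    exact (hcon (z, w) (Finset.mk_mem_product hz hw)).le
  have hterm : ∀ p ∈ intBall (Fin n) (2 * ⌈κ⌉₊) ×ˢ intBall (Fin m) (2 * ⌈κ'⌉₊),
      P.real {ω | T ≤ ∑ i, (p.2 i : ℝ) * (A ω).mulVec (fun j => (p.1 j : ℝ)) i} ≤
        Real.exp (-(δ ^ 2 * m * (a * b) / 8)) := by
    intro p hp
    obtain ⟨hp1, hp2⟩ := Finset.mem_product.1 hp
    refine (hA.measureReal_bilin_ge_le _ _ (mem_intBall.1 hp1) (mem_intBall.1 hp2)
      (by positivity)).trans (Real.exp_le_exp.2 (le_of_eq ?_))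
    rw [hT, ha, hb, mul_pow, mul_pow, div_pow, div_pow, Real.sq_sqrt hκ.le, Real.sq_sqrt hκ'.le]
    field_simp
    norm_num
  have hcard1 : ((intBall (Fin n) (2 * ⌈κ⌉₊)).card : ℝ) ≤ Real.exp (a * (δ ^ 2 * m / 32)) := by
    refine (card_intBall_le hκ hκn (by linarith)).trans (Real.exp_le_exp.2 ?_)
    calc 2 * (⌈κ⌉₊ : ℝ) * (Real.log (2 * n / κ) + 1)
        = a * (2 * κ * (Real.log (2 * n / κ) + 1)) := by rw [ha]; field_simp
      _ ≤ _ := by gcongr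
  have hcard2 : ((intBall (Fin m) (2 * ⌈κ'⌉₊)).card : ℝ) ≤ Real.exp (b * (δ ^ 2 * m / 32)) := by
    refine (card_intBall_le hκ' hκm (by linarith)).trans (Real.exp_le_exp.2 ?_)
    calc 2 * (⌈κ'⌉₊ : ℝ) * (Real.log (2 * m / κ') + 1)
        = b * (2 * κ' * (Real.log (2 * m / κ') + 1)) := by rw [hb]; field_simp
      _ ≤ _ := by gcongr
  refine (measureReal_mono hsub (measure_ne_top _ _)).trans <| (measureReal_biUnion_finset_le _ _).trans <|
    (Finset.sum_le_sum hterm).trans ?_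
  rw [Finset.sum_const, Finset.card_product, nsmul_eq_mul, Nat.cast_mul]
  calc _ ≤ Real.exp (a * (δ ^ 2 * m / 32)) * Real.exp (b * (δ ^ 2 * m / 32)) *
        Real.exp (-(δ ^ 2 * m * (a * b) / 8)) := by gcongr
    _ ≤ Real.exp (-(δ ^ 2 * m / 16)) := by
      rw [← Real.exp_add, ← Real.exp_add, Real.exp_le_exp]
      have hm : 0 ≤ δ ^ 2 * m := by positivity
      -- The rounding losses `a, b ≥ 1` enter the entropy as `a + b` but the tail as `a * b`, so
      -- they do no harm.
      have h1 : a + b ≤ 2 * (a * b) := by nlinarith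
      have h2 : 1 ≤ a * b := by nlinarith
      nlinarith

/-- At most `exp (m / 8)` points compete with a tail of `exp (-m / 4)` each. -/
theorem IsGaussianSensingMatrix.measureReal_not_intBall_lower_le [IsProbabilityMeasure P]
    (hA : IsGaussianSensingMatrix P A) (hm : 0 < m) {κ : ℝ} (hκ : 0 < κ) (hκn : κ ≤ n)
    (hc : 2 * κ * (Real.log (2 * n / κ) + 1) ≤ m / 8) :
    P.real {ω | ¬ ∀ z ∈ intBall (Fin n) κ, (∑ j, (z j : ℝ) ^ 2) / 4 ≤
      ∑ i, (A ω).mulVec (fun j => (z j : ℝ)) i ^ 2} ≤ Real.exp (-(m / 8 : ℝ)) := by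
  have hsub : {ω | ¬ ∀ z ∈ intBall (Fin n) κ, (∑ j, (z j : ℝ) ^ 2) / 4 ≤
      ∑ i, (A ω).mulVec (fun j => (z j : ℝ)) i ^ 2} ⊆ ⋃ z ∈ intBall (Fin n) κ,
        {ω | ∑ i, (A ω).mulVec (fun j => (z j : ℝ)) i ^ 2 < (∑ j, (z j : ℝ) ^ 2) / 4} := by
    intro ω hω
    simp only [Set.mem_ofPred_eq, not_forall, not_le] at hω
    obtain ⟨z, hz, h⟩ := hω
    exact Set.mem_biUnion (Finset.mem_coe.2 hz) h
  have hcard : ((intBall (Fin n) κ).card : ℝ) ≤ Real.exp (m / 8) :=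
    (Nat.cast_le.2 (Finset.card_le_card (intBall_mono (by linarith)))).trans <|
      (card_intBall_le hκ hκn le_rfl).trans (Real.exp_le_exp.2 hc)
  refine (measureReal_mono hsub (measure_ne_top _ _)).trans <| (measureReal_biUnion_finset_le _ _).trans <|
    (Finset.sum_le_sum fun z _ => hA.measureReal_sum_sq_lt_le hm _).trans ?_
  rw [Finset.sum_const, nsmul_eq_mul]
  calc _ ≤ Real.exp (m / 8) * Real.exp (-(m / 4 : ℝ)) := by gcongr
    _ = _ := by rw [← Real.exp_add]; congr 1; ring

end

/-! ### Lower bounds on the cone -/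

/-- For `κ' = m` the `ℓ₁` constraint on `g` is automatic by Cauchy–Schwarz, so `g = A h` is
admissible. -/
theorem ChevetBound.norm_applyMat_le {m n : ℕ} {A : Matrix (Fin m) (Fin n) ℝ} {κ D r : ℝ}
    (hA : ChevetBound A κ m D) {h : EuclideanSpace ℝ (Fin n)} (hD : 0 ≤ D) (hr : ‖h‖ ≤ r)
    (hr1 : l1norm h ≤ r * √κ) : ‖applyMat A h‖ ≤ D * r := by
  have := hA h (applyMat A h) r ‖applyMat A h‖ hr hr1 le_rfl (l1norm_le_sqrt_mul_norm _)
  simp_rw [← sq] at this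
  rw [← norm_sq_eq_sum, sq] at this
  rcases (norm_nonneg (applyMat A h)).eq_or_lt with h0 | h0
  · rw [← h0]; exact mul_nonneg hD ((norm_nonneg _).trans hr)
  · exact le_of_mul_le_mul_right this h0

/-- A lower bound for `‖A h‖` on vectors of small `ℓ₁`-norm, from a lower bound at
integer points. -/
theorem norm_applyMat_ge {m n : ℕ} {A : Matrix (Fin m) (Fin n) ℝ} {κ q : ℝ} (hκ : 0 < κ)
    (hq0 : 0 ≤ q) (hq1 : q ≤ 1) (hA : ChevetBound A κ m 64)
    (hlow : ∀ z ∈ intBall (Fin n) κ, (∑ j, (z j : ℝ) ^ 2) / 4 ≤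
      ∑ i, A.mulVec (fun j => (z j : ℝ)) i ^ 2)
    {h : EuclideanSpace ℝ (Fin n)} (hh : ‖h‖ ≤ 1) (hh1 : l1norm h ≤ q * √κ) :
    ‖h‖ / 2 - 65 * √q ≤ ‖applyMat A h‖ := by
  have hsκ : 0 < √κ := Real.sqrt_pos.2 hκ
  have hsq : √κ ^ 2 = κ := Real.sq_sqrt hκ.le
  set z : Fin n → ℤ := fun i => truncInt (√κ * h i) with hz
  set ζ : EuclideanSpace ℝ (Fin n) := WithLp.toLp 2 fun j => (z j : ℝ) with hζ
  set d := h - (√κ)⁻¹ • ζ with hd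
  have hzmem : z ∈ intBall (Fin n) κ := by
    rw [mem_intBall]
    calc ∑ i, (z i : ℝ) ^ 2 ≤ ∑ i, (√κ * h i) ^ 2 :=
          Finset.sum_le_sum fun i _ => sq_le_sq.2 (abs_truncInt_le _)
      _ = κ * ‖h‖ ^ 2 := by
          rw [norm_sq_eq_sum, Finset.mul_sum]; simp_rw [mul_pow, hsq]
      _ ≤ κ * 1 ^ 2 := by gcongr
      _ = κ := by ring
  have hdi : ∀ i, d i = (√κ)⁻¹ * (√κ * h i - truncInt (√κ * h i)) := by
    intro i
    simp only [hd, hζ, hz, PiLp.sub_apply, PiLp.smul_apply, smul_eq_mul]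
    field_simp
  have hd1 : ∀ i, |d i| ≤ |h i| := by
    intro i
    rw [hdi, abs_mul, abs_of_pos (inv_pos.2 hsκ), inv_mul_le_iff₀ hsκ]
    refine (abs_sub_truncInt_le _).trans ?_
    rw [abs_mul, abs_of_pos hsκ]
  have hd2 : ∀ i, |d i| ≤ (√κ)⁻¹ := by
    intro i
    rw [hdi, abs_mul, abs_of_pos (inv_pos.2 hsκ)]
    exact mul_le_of_le_one_right (inv_pos.2 hsκ).le (abs_sub_truncInt_le_one _)
  have hqs : q ≤ √q := Real.le_sqrt_of_sq_le (by nlinarith)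
  have hl1 : l1norm d ≤ √q * √κ :=
    (Finset.sum_le_sum fun i _ => hd1 i).trans (hh1.trans (by gcongr))
  -- Interpolation: `|d i|` is at most both `1 / √κ` and `|h i|`, so `‖d‖ ^ 2 ≤ l1norm h / √κ ≤ q`.
  have hl2 : ‖d‖ ≤ √q := by
    refine Real.le_sqrt_of_sq_le ?_
    calc ‖d‖ ^ 2 = ∑ i, |d i| * |d i| := by
          rw [norm_sq_eq_sum]; simp_rw [← sq, sq_abs]
      _ ≤ ∑ i, (√κ)⁻¹ * |h i| :=
          Finset.sum_le_sum fun i _ => mul_le_mul (hd2 i) (hd1 i) (abs_nonneg _) (by positivity)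
      _ = (√κ)⁻¹ * l1norm h := by rw [← Finset.mul_sum]; rfl
      _ ≤ (√κ)⁻¹ * (q * √κ) := by gcongr
      _ = q := by field_simp
  have hAd : ‖applyMat A d‖ ≤ 64 * √q := hA.norm_applyMat_le (by norm_num) hl2 hl1
  have hAζ : ‖ζ‖ / 2 ≤ ‖applyMat A ζ‖ := by
    refine le_of_sq_le_sq ?_ (norm_nonneg _)
    rw [div_pow, norm_sq_eq_sum, norm_sq_eq_sum]
    have := hlow z hzmem
    norm_num
    exact this
  have hhd : h = d + (√κ)⁻¹ • ζ := by rw [hd]; abel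
  have hAh : (√κ)⁻¹ • applyMat A ζ = applyMat A h - applyMat A d := by
    rw [eq_sub_iff_add_eq', ← applyMat_smul, ← applyMat_add, ← hhd]
  have h1 : (√κ)⁻¹ * ‖applyMat A ζ‖ ≤ ‖applyMat A h‖ + ‖applyMat A d‖ := by
    have := norm_sub_le (applyMat A h) (applyMat A d)
    rwa [← hAh, norm_smul, Real.norm_of_nonneg (by positivity)] at this
  have h2 : ‖h‖ ≤ ‖d‖ + (√κ)⁻¹ * ‖ζ‖ := by
    have := norm_add_le d ((√κ)⁻¹ • ζ)
    rwa [← hhd, norm_smul, Real.norm_of_nonneg (by positivity)] at this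
  have h3 : (√κ)⁻¹ * (‖ζ‖ / 2) ≤ (√κ)⁻¹ * ‖applyMat A ζ‖ := by gcongr
  linarith [Real.sqrt_nonneg q]

/-- Injectivity of `(h, g) ↦ A h + g` on pairs of vectors of small `ℓ₁`-norm. -/
theorem norm_applyMat_add_ge {m n : ℕ} {A : Matrix (Fin m) (Fin n) ℝ} {κ κ' q : ℝ} (hκ : 0 < κ)
    (hq0 : 0 ≤ q) (hq : q ≤ 1 / 2 ^ 20) (hA : ChevetBound A κ m 64)
    (hA' : ChevetBound A κ κ' (1 / 128))
    (hlow : ∀ z ∈ intBall (Fin n) κ, (∑ j, (z j : ℝ) ^ 2) / 4 ≤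
      ∑ i, A.mulVec (fun j => (z j : ℝ)) i ^ 2)
    (h : EuclideanSpace ℝ (Fin n)) (g : EuclideanSpace ℝ (Fin m))
    (hh1 : l1norm h ≤ q * √κ * (‖h‖ + ‖g‖)) (hg1 : l1norm g ≤ q * √κ' * (‖h‖ + ‖g‖)) :
    (‖h‖ + ‖g‖) / 8 ≤ ‖applyMat A h + g‖ := by
  have key : ∀ (h : EuclideanSpace ℝ (Fin n)) (g : EuclideanSpace ℝ (Fin m)), ‖h‖ + ‖g‖ = 1 →
      l1norm h ≤ q * √κ → l1norm g ≤ q * √κ' → 1 / 8 ≤ ‖applyMat A h + g‖ := by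
    intro h g hone hh hg
    have hn := norm_nonneg h
    have hn' := norm_nonneg g
    have hlo := norm_applyMat_ge hκ hq0 (by linarith) hA hlow (h := h) (by linarith) hh
    have hsq : √q ≤ 1 / 2 ^ 10 := by
      rw [Real.sqrt_le_left (by norm_num)]
      norm_num at hq ⊢
      exact hq
    have hneg : l1norm (-g) = l1norm g := by simp [l1norm]
    have hq1 : q ≤ 1 := by linarith
    have hin := hA' h (-g) 1 1 (by linarith)
      (hh.trans (mul_le_mul_of_nonneg_right hq1 (Real.sqrt_nonneg _)))
      (by rw [norm_neg]; linarith)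
      (by rw [hneg]; exact hg.trans (mul_le_mul_of_nonneg_right hq1 (Real.sqrt_nonneg _)))
    have hinner : ∑ i, (-g) i * applyMat A h i = -inner ℝ (applyMat A h) g := by
      simp [PiLp.inner_apply]
    rw [hinner] at hin
    have hexp := norm_add_sq_real (applyMat A h) g
    refine le_of_sq_le_sq ?_ (norm_nonneg _)
    -- With `‖h‖ + ‖g‖ = 1` the sum is at least `1 / 2 - 65 / 2 ^ 10`. Then `‖A h + g‖ ^ 2 ≥ (3 / 8)
    -- ^ 2 / 2 - 2 / 128 ≥ 1 / 64`.
    have hsum : 3 / 8 ≤ ‖applyMat A h‖ + ‖g‖ := by linarith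
    nlinarith [sq_nonneg (‖applyMat A h‖ - ‖g‖)]
  rcases (add_nonneg (norm_nonneg h) (norm_nonneg g)).eq_or_lt with h0 | h0
  · rw [← h0]; simp
  · set N := ‖h‖ + ‖g‖ with hN
    have hi : 0 < N⁻¹ := inv_pos.2 h0
    have := key (N⁻¹ • h) (N⁻¹ • g)
      (by rw [norm_smul, norm_smul, Real.norm_of_nonneg hi.le, ← mul_add, ← hN,
        inv_mul_cancel₀ h0.ne'])
      (by rw [l1norm_smul, abs_of_pos hi, inv_mul_le_iff₀ h0]; linarith)
      (by rw [l1norm_smul, abs_of_pos hi, inv_mul_le_iff₀ h0]; linarith)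
    rw [applyMat_smul, ← smul_add, norm_smul, Real.norm_of_nonneg hi.le, inv_mul_eq_div,
      le_div_iff₀ h0] at this
    linarith

/-! ### The convex program -/

theorem norm_le_l1norm {k : ℕ} (v : EuclideanSpace ℝ (Fin k)) : ‖v‖ ≤ l1norm v := by
  refine le_of_sq_le_sq ?_ (l1norm_nonneg v)
  rw [norm_sq_eq_sum]
  simp_rw [← sq_abs (v _)]
  exact Finset.sum_sq_le_sq_sum_of_nonneg fun _ _ => abs_nonneg _

theorem continuous_l1norm {k : ℕ} : Continuous (l1norm (k := k)) := by
  unfold l1norm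
  fun_prop

/-- Off the support of `x`, `|h i|` is exactly the growth of the objective. On the support the
growth is at least `-|h i|`, and Cauchy–Schwarz bounds the sum of `|h i|` there. -/
theorem l1norm_le_of_l0norm {k : ℕ} (x h : EuclideanSpace ℝ (Fin k)) {s : ℝ}
    (hs : (l0norm x : ℝ) ≤ s) :
    l1norm h ≤ 2 * √s * ‖h‖ + (l1norm (x + h) - l1norm x) := by
  set S := Finset.univ.filter fun i => x i ≠ 0 with hS
  have h1 : ∑ i ∈ S, |h i| ≤ √s * ‖h‖ := by
    refine le_of_sq_le_sq ?_ (by positivity)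
    rw [mul_pow, Real.sq_sqrt ((Nat.cast_nonneg _).trans hs), norm_sq_eq_sum]
    have hcs := sq_sum_le_card_mul_sum_sq (s := S) (f := fun i => |h i|)
    simp only [sq_abs] at hcs
    refine hcs.trans (mul_le_mul hs ?_ (Finset.sum_nonneg fun _ _ => sq_nonneg _)
      ((Nat.cast_nonneg _).trans hs))
    exact Finset.sum_le_sum_of_subset_of_nonneg (Finset.subset_univ _) fun _ _ _ => sq_nonneg _
  have h2 : ∀ i, |h i| ≤ 2 * (if i ∈ S then |h i| else 0) + (|(x + h) i| - |x i|) := by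
    intro i
    rw [PiLp.add_apply]
    split_ifs with hi
    · have := abs_sub_abs_le_abs_sub (x i) (x i + h i)
      rw [sub_add_cancel_left, abs_neg] at this
      linarith
    · have : x i = 0 := by simpa [hS] using hi
      simp [this]
  have h3 := Finset.sum_le_sum fun i (_ : i ∈ Finset.univ) => h2 i
  rw [Finset.sum_add_distrib, ← Finset.mul_sum, Finset.sum_sub_distrib, Finset.sum_ite_mem,
    Finset.univ_inter] at h3
  unfold l1norm
  linarith

/-- Because `l > 0` the objective is coercive, so it suffices to minimize over a compact sublevel
set. -/
theorem exists_isSolution {m n : ℕ} (A : Matrix (Fin m) (Fin n) ℝ)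
    (y : EuclideanSpace ℝ (Fin m)) (ε : ℝ) {l : ℝ} (hl : 0 < l)
    (hne : (feasibleSet A y ε).Nonempty) : ∃ xhat fhat, IsSolution A y ε l xhat fhat := by
  obtain ⟨p₀, hp₀⟩ := hne
  set F : EuclideanSpace ℝ (Fin n) × EuclideanSpace ℝ (Fin m) → ℝ :=
    fun p => l1norm p.1 + l * l1norm p.2 with hF
  have hFc : Continuous F :=
    (continuous_l1norm.comp continuous_fst).add
      (continuous_const.mul (continuous_l1norm.comp continuous_snd))
  have hclosed : IsClosed (feasibleSet A y ε) := by
    refine isClosed_le ?_ continuous_const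
    exact ((((continuous_applyMat A).comp continuous_fst).add continuous_snd).sub
      continuous_const).norm
  have hK : IsCompact (feasibleSet A y ε ∩ {p | F p ≤ F p₀}) := by
    refine Metric.isCompact_of_isClosed_isBounded
      (hclosed.inter (isClosed_le hFc continuous_const)) ?_
    refine (Metric.isBounded_closedBall (x := 0) (r := max (F p₀) (F p₀ / l))).subset ?_
    rintro p ⟨-, hp⟩
    have hp : l1norm p.1 + l * l1norm p.2 ≤ F p₀ := hp
    rw [mem_closedBall_zero_iff, Prod.norm_def]
    have h1 := l1norm_nonneg p.1
    have h2 := mul_nonneg hl.le (l1norm_nonneg p.2)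
    refine max_le_max ((norm_le_l1norm _).trans (by linarith)) ((norm_le_l1norm _).trans ?_)
    rw [le_div_iff₀ hl]
    linarith
  obtain ⟨p, hp, hmin⟩ := hK.exists_isMinOn ⟨p₀, hp₀, le_refl (F p₀)⟩ hFc.continuousOn
  refine ⟨p.1, p.2, hp.1, fun q hq => ?_⟩
  rcases le_or_gt (F q) (F p₀) with h | h
  · exact hmin ⟨hq, h⟩
  · exact (show F p ≤ F p₀ from hp.2).trans h.le

/-- Stable recovery from the deterministic properties of the sensing matrix; `L` stands for
`log (n / m) + 1`. -/
theorem norm_sub_add_norm_sub_le_of_isSolution {m n : ℕ} {A : Matrix (Fin m) (Fin n) ℝ}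
    {L : ℝ} (hm : 0 < m) (hL : 0 < L)
    (hA : ChevetBound A (1 / 2 ^ 40 * m / L) m 64)
    (hA' : ChevetBound A (1 / 2 ^ 40 * m / L) (1 / 2 ^ 40 * m) (1 / 128))
    (hlow : ∀ z ∈ intBall (Fin n) (1 / 2 ^ 40 * m / L), (∑ j, (z j : ℝ) ^ 2) / 4 ≤
      ∑ i, A.mulVec (fun j => (z j : ℝ)) i ^ 2)
    {x xhat : EuclideanSpace ℝ (Fin n)} {f fhat w y : EuclideanSpace ℝ (Fin m)} {ε : ℝ}
    (hx : (l0norm x : ℝ) ≤ 1 / 2 ^ 82 * m / L) (hf : (l0norm f : ℝ) ≤ 1 / 2 ^ 82 * m)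
    (hw : ‖w‖ ≤ ε) (hy : y = applyMat A x + f + w)
    (hsol : IsSolution A y ε (1 / √L) xhat fhat) :
    ‖xhat - x‖ + ‖fhat - f‖ ≤ 16 * ε := by
  have hm' : (0 : ℝ) < m := by exact_mod_cast hm
  have hsL : 0 < √L := Real.sqrt_pos.2 hL
  obtain ⟨hfeas, hmin⟩ := hsol
  set h := xhat - x with hh
  set g := fhat - f with hg
  have hxh : x + h = xhat := by rw [hh]; abel
  have hfg : f + g = fhat := by rw [hg]; abel
  have hfeas0 : (x, f) ∈ feasibleSet A y ε := by
    change ‖applyMat A x + f - y‖ ≤ ε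
    rw [hy, sub_add_cancel_left, norm_neg]
    exact hw
  have hobj : l1norm xhat + 1 / √L * l1norm fhat ≤ l1norm x + 1 / √L * l1norm f := hmin hfeas0
  have h1 := l1norm_le_of_l0norm x h hx
  have h2 := l1norm_le_of_l0norm f g hf
  rw [hxh] at h1
  rw [hfg] at h2
  have hs82 : √(1 / 2 ^ 82 * m : ℝ) = 1 / 2 ^ 41 * √m := by
    rw [Real.sqrt_mul (by positivity)]
    congr 1
    rw [Real.sqrt_eq_iff_mul_self_eq (by positivity) (by positivity)]
    norm_num
  have hs40 : √(1 / 2 ^ 40 * m : ℝ) = 1 / 2 ^ 20 * √m := by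
    rw [Real.sqrt_mul (by positivity)]
    congr 1
    rw [Real.sqrt_eq_iff_mul_self_eq (by positivity) (by positivity)]
    norm_num
  rw [Real.sqrt_div (by positivity), hs82] at h1
  rw [hs82] at h2
  have h3 : 1 / √L * l1norm g ≤
      1 / √L * (2 * (1 / 2 ^ 41 * √m) * ‖g‖ + (l1norm fhat - l1norm f)) := by gcongr
  -- The constants match: `2 * 2 ^ (-41) = 2 ^ (-20) * √(2 ^ (-40))`, that is, `q` times the square
  -- root of the constant in `κ`.
  have hcone : l1norm h + 1 / √L * l1norm g ≤ 2 * (1 / 2 ^ 41 * √m / √L) * (‖h‖ + ‖g‖) := by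
    have : 1 / √L * (2 * (1 / 2 ^ 41 * √m) * ‖g‖ + (l1norm fhat - l1norm f)) =
      2 * (1 / 2 ^ 41 * √m / √L) * ‖g‖ + (1 / √L * l1norm fhat - 1 / √L * l1norm f) := by ring
    linarith
  have hl1 : l1norm h ≤ 1 / 2 ^ 20 * √(1 / 2 ^ 40 * m / L : ℝ) * (‖h‖ + ‖g‖) := by
    rw [Real.sqrt_div (by positivity), hs40]
    have : 0 ≤ 1 / √L * l1norm g := mul_nonneg (by positivity) (l1norm_nonneg g)
    calc l1norm h ≤ 2 * (1 / 2 ^ 41 * √m / √L) * (‖h‖ + ‖g‖) := by linarith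
      _ = _ := by ring
  have hl2 : l1norm g ≤ 1 / 2 ^ 20 * √(1 / 2 ^ 40 * m : ℝ) * (‖h‖ + ‖g‖) := by
    rw [hs40]
    have h0 := l1norm_nonneg h
    have : 1 / √L * l1norm g ≤ 2 * (1 / 2 ^ 41 * √m / √L) * (‖h‖ + ‖g‖) := by linarith
    have h4 := mul_le_mul_of_nonneg_left this hsL.le
    have h5 : √L * (1 / √L * l1norm g) = l1norm g := by field_simp
    have h6 : √L * (2 * (1 / 2 ^ 41 * √m / √L) * (‖h‖ + ‖g‖)) =
      1 / 2 ^ 20 * (1 / 2 ^ 20 * √m) * (‖h‖ + ‖g‖) := by field_simp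
    linarith
  have hmain := norm_applyMat_add_ge (q := 1 / 2 ^ 20) (by positivity) (by positivity) le_rfl
    hA hA' hlow h g hl1 hl2
  have htri : ‖applyMat A h + g‖ ≤ ε + ε := by
    have hadd : applyMat A xhat = applyMat A x + applyMat A h := by
      rw [← applyMat_add, hxh]
    have : applyMat A h + g = (applyMat A xhat + fhat - y) + w := by
      rw [hadd, hy, hg]; abel
    rw [this]
    exact (norm_add_le _ _).trans (add_le_add hfeas hw)
  linarith

/-! ### Choice of constants and conclusion -/

/-- The logarithm is `O(L)`, and the `1 / L` in `κ` cancels it. The target `2 ^ (-23) * m` is `δ ^ 2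
* m / 32` at `δ = 1 / 512`. -/
theorem entropy_le {m n : ℕ} (hm : 0 < m) (hmn : m ≤ n) {L : ℝ}
    (hL : L = Real.log ((n : ℝ) / m) + 1) :
    2 * (1 / 2 ^ 40 * m / L) * (Real.log (2 * n / (1 / 2 ^ 40 * m / L)) + 1) ≤
      1 / 2 ^ 23 * (m : ℝ) := by
  have hm' : (0 : ℝ) < m := by exact_mod_cast hm
  have hn' : (0 : ℝ) < n := by exact_mod_cast hm.trans_le hmn
  have hlog : 0 ≤ Real.log ((n : ℝ) / m) :=
    Real.log_nonneg ((one_le_div hm').2 (by exact_mod_cast hmn))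
  have hL1 : 1 ≤ L := by linarith
  have hL0 : 0 < L := by linarith
  have h1 : 2 * (n : ℝ) / (1 / 2 ^ 40 * m / L) = 2 ^ 41 * (L * (n / m)) := by
    field_simp
  have h2 : Real.log (2 * n / (1 / 2 ^ 40 * m / L)) ≤ 41 + 2 * L := by
    rw [h1, Real.log_mul (by positivity) (by positivity), Real.log_mul (by positivity)
      (by positivity), Real.log_pow]
    have := Real.log_le_sub_one_of_pos hL0
    have := Real.log_two_lt_d9
    push_cast
    linarith
  calc _ ≤ 2 * (1 / 2 ^ 40 * m / L) * (41 + 2 * L + 1) := by gcongr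
    _ ≤ 2 * (1 / 2 ^ 40 * m / L) * (44 * L) := by gcongr; linarith
    _ = 88 / 2 ^ 40 * m := by field_simp; norm_num
    _ ≤ _ := mul_le_mul_of_nonneg_right (by norm_num) hm'.le

theorem theorem1p1 :
    ∃ α C c K : ℝ, 0 < α ∧ 0 < C ∧ 0 < c ∧ 0 < K ∧
      ∀ (m n : ℕ), 0 < m → m < n →
      ∀ (Ω : Type*) [MeasurableSpace Ω] (P : Measure Ω) [IsProbabilityMeasure P]
        (A : Ω → Matrix (Fin m) (Fin n) ℝ), IsGaussianSensingMatrix P A →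
      ∃ E : Set Ω, MeasurableSet E ∧ 1 - C * Real.exp (-c * (m : ℝ)) ≤ P.real E ∧
        ∀ ω ∈ E, ∀ (x : EuclideanSpace ℝ (Fin n)) (f : EuclideanSpace ℝ (Fin m)),
          (l0norm x : ℝ) ≤ α * (m : ℝ) / (Real.log ((n : ℝ) / (m : ℝ)) + 1) →
          (l0norm f : ℝ) ≤ α * (m : ℝ) →
          ∀ (ε : ℝ) (w y : EuclideanSpace ℝ (Fin m)), ‖w‖ ≤ ε →
            y = applyMat (A ω) x + f + w →
            (∃ xhat fhat, IsSolution (A ω) y ε (lam n m) xhat fhat) ∧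
            ∀ xhat fhat, IsSolution (A ω) y ε (lam n m) xhat fhat →
              ‖xhat - x‖ + ‖fhat - f‖ ≤ K * ε := by
  refine ⟨1 / 2 ^ 82, 3, 1 / 2 ^ 22, 16, by norm_num, by norm_num, by norm_num, by norm_num, ?_⟩
  intro m n hm hmn Ω _ P _ A hA
  have hm' : (0 : ℝ) < m := by exact_mod_cast hm
  have hmn' : (m : ℝ) ≤ n := by exact_mod_cast hmn.le
  have hlog : 0 ≤ Real.log ((n : ℝ) / m) := Real.log_nonneg ((one_le_div hm').2 hmn')
  set L : ℝ := Real.log ((n : ℝ) / m) + 1 with hL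
  have hL1 : 1 ≤ L := by linarith
  have hL0 : 0 < L := by linarith
  set κ : ℝ := 1 / 2 ^ 40 * m / L with hκ
  have hκ0 : 0 < κ := by positivity
  have hκm : κ ≤ m := by
    rw [hκ, div_le_iff₀ hL0]
    nlinarith
  have hent := entropy_le hm hmn.le hL
  have hent' : 2 * (1 / 2 ^ 40 * m) * (Real.log (2 * m / (1 / 2 ^ 40 * m)) + 1) ≤
      1 / 2 ^ 23 * (m : ℝ) := by
    simpa using entropy_le hm le_rfl (L := 1) (by simp [hm'.ne'])
  have hentm : 2 * (m : ℝ) * (Real.log (2 * m / m) + 1) ≤ 16 ^ 2 * m / 32 := by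
    rw [mul_div_assoc, div_self hm'.ne', mul_one]
    have := Real.log_two_lt_d9
    nlinarith
  -- With `κ' = m` the entropy is of order `m`, so `δ` must be large. In `hb2` both entropies are
  -- small, so `δ = 1 / 512` is allowed; its exponent `δ ^ 2 / 16 = 2 ^ (-22)` is the final `c`.
  have hb1 := hA.measureReal_not_chevetBound_le (δ := 16) hκ0 (hκm.trans hmn') hm' le_rfl
    (by norm_num) (hent.trans (by linarith)) hentm
  have hb2 := hA.measureReal_not_chevetBound_le (κ' := 1 / 2 ^ 40 * m) (δ := 1 / 512) hκ0
    (hκm.trans hmn') (by positivity) (by linarith) (by norm_num) (hent.trans (by linarith))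
    (hent'.trans (by linarith))
  have hb3 := hA.measureReal_not_intBall_lower_le hm hκ0 (hκm.trans hmn') (hent.trans (by linarith))
  rw [show (4 : ℝ) * 16 = 64 by norm_num] at hb1
  rw [show (4 : ℝ) * (1 / 512) = 1 / 128 by norm_num] at hb2
  set B1 := {ω | ¬ ChevetBound (A ω) κ m 64}
  set B2 := {ω | ¬ ChevetBound (A ω) κ (1 / 2 ^ 40 * m) (1 / 128)}
  set B3 := {ω | ¬ ∀ z ∈ intBall (Fin n) κ, (∑ j, (z j : ℝ) ^ 2) / 4 ≤
      ∑ i, (A ω).mulVec (fun j => (z j : ℝ)) i ^ 2}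
  have hB : P.real (B1 ∪ B2 ∪ B3) ≤ 3 * Real.exp (-(1 / 2 ^ 22) * m) := by
    have h1 : P.real B1 ≤ Real.exp (-(1 / 2 ^ 22) * m) :=
      hb1.trans (Real.exp_le_exp.2 (by linarith))
    have h2 : P.real B2 ≤ Real.exp (-(1 / 2 ^ 22) * m) :=
      hb2.trans (Real.exp_le_exp.2 (by linarith))
    have h3 : P.real B3 ≤ Real.exp (-(1 / 2 ^ 22) * m) :=
      hb3.trans (Real.exp_le_exp.2 (by linarith))
    have h4 := measureReal_union_le (μ := P) (B1 ∪ B2) B3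
    have h5 := measureReal_union_le (μ := P) B1 B2
    linarith
  -- The entries are only almost everywhere measurable, so the bad set is replaced by a measurable
  -- hull of equal measure.
  refine ⟨(toMeasurable P (B1 ∪ B2 ∪ B3))ᶜ, (measurableSet_toMeasurable _ _).compl, ?_, ?_⟩
  · rw [probReal_compl_eq_one_sub (measurableSet_toMeasurable _ _), measureReal_def,
      measure_toMeasurable, ← measureReal_def]
    linarith
  · intro ω hω x f hx hf ε w y hw hy
    have hω' : ω ∉ B1 ∪ B2 ∪ B3 := fun h => hω (subset_toMeasurable P _ h)
    simp only [Set.mem_union, not_or] at hω'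
    obtain ⟨⟨h1, h2⟩, h3⟩ := hω'
    refine ⟨exists_isSolution (A ω) y ε (one_div_pos.2 (Real.sqrt_pos.2 hL0)) ⟨(x, f), ?_⟩,
      fun xhat fhat hsol => ?_⟩
    · change ‖applyMat (A ω) x + f - y‖ ≤ ε
      rw [hy, sub_add_cancel_left, norm_neg]
      exact hw
    · exact norm_sub_add_norm_sub_le_of_isSolution hm hL0 (not_not.1 h1) (not_not.1 h2)
        (not_not.1 h3) hx hf hw hy hsol
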